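/- Let $n$ be a natural number and let $N$ be a norm on the space $\mathbb{M}_n$ of complex $n\times n$ matrices that is multiplicative ($N(XY)\le N(X)N(Y)$ for all $X,Y$), unitarily invariant ($N(UXV)=N(X)$ for all $X$ and all unitary $U,V$) and self-adjoint ($N(X^*)=N(X)$ for all $X$). For $X\in\mathbb{M}_n$ put $\operatorname{Re}(X)=\frac{X+X^*}{2}$, let $$\omega_N(X)=\sup_{\theta\in\mathbb{R}}N\big(\operatorname{Re}(e^{i\theta}X)\big)$$ be the generalized numerical radius, and let $W(X)=\{\langle Xx,x\rangle : x\in\mathbb{C}^n,\ \|x\|=1\}$ be the numerical range, where $\langle\cdot,\cdot\rangle$ is the standard inner product and $\|\cdot\|$ the Euclidean norm. For $\alpha\in[0,\pi/2)$ let $S_\alpha=\{x+iy\in\mathbb{C} : x>0,\ |y|\le\tan(\alpha)\,x\}$. 1. If $\alpha\in[0,\pi/2)$, $X\in\mathbb{M}_n$ and $W(X)\subseteq S_\alpha$, then $\omega_N(X)\le\sec(\alpha)\,\omega_N(\operatorname{Re}(X))$. 2. For every $X\in\mathbb{M}_n$, $\omega_N(X)\le N(X)$. -/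

import Mathlib

open scoped ComplexStarModule

noncomputable section

/-- The numerical range `W(X) = {⟨Xx, x⟩ : x ∈ ℂⁿ, ‖x‖ = 1}`, with the Euclidean norm and the
standard inner product. Mathlib's inner product is linear in its second argument, so the
mathematical `⟨Xx, x⟩` (linear in the first) is `inner ℂ x (X x)`. -/
def numericalRange {n : ℕ} (X : Matrix (Fin n) (Fin n) ℂ) : Set ℂ :=
  {z | ∃ x : EuclideanSpace ℂ (Fin n), ‖x‖ = 1 ∧ inner ℂ x (Matrix.toEuclideanLin X x) = z}

/-- The sector `S_α = {x + iy : x > 0, |y| ≤ tan(α) x}`. -/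
def sector (α : ℝ) : Set ℂ :=
  {z | 0 < z.re ∧ |z.im| ≤ Real.tan α * z.re}

/-- A multiplicative, unitarily invariant, self-adjoint norm on the complex `n × n` matrices.
The triangle inequality, absolute homogeneity and nonnegativity are part of `Seminorm`. -/
structure IsAdmissibleNorm {n : ℕ} (N : Seminorm ℂ (Matrix (Fin n) (Fin n) ℂ)) : Prop where
  definite : ∀ X, N X = 0 → X = 0
  multiplicative : ∀ X Y, N (X * Y) ≤ N X * N Y
  unitarily_invariant : ∀ X, ∀ U ∈ Matrix.unitaryGroup (Fin n) ℂ,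
    ∀ V ∈ Matrix.unitaryGroup (Fin n) ℂ, N (U * X * V) = N X
  self_adjoint : ∀ X, N X.conjTranspose = N X

/-- The generalized numerical radius `ω_N(X) = sup_θ N(Re(e^{iθ} X))`, where
`ℜ A = (A + A*) / 2`. -/
def genNumericalRadius {n : ℕ} (N : Seminorm ℂ (Matrix (Fin n) (Fin n) ℂ))
    (X : Matrix (Fin n) (Fin n) ℂ) : ℝ :=
  ⨆ θ : ℝ, N (ℜ (Complex.exp (θ * Complex.I) • X) : Matrix (Fin n) (Fin n) ℂ)

/-- The supremum in `genNumericalRadius` is over a bounded set, so it is a genuine supremum. -/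
theorem genNumericalRadius_bddAbove {n : ℕ} (N : Seminorm ℂ (Matrix (Fin n) (Fin n) ℂ))
    (X : Matrix (Fin n) (Fin n) ℂ) :
    BddAbove (Set.range fun θ : ℝ =>
      N (ℜ (Complex.exp (θ * Complex.I) • X) : Matrix (Fin n) (Fin n) ℂ)) := by
  refine ⟨2⁻¹ * (N X + N (star X)), ?_⟩
  rintro _ ⟨θ, rfl⟩
  have h1 : ‖Complex.exp (θ * Complex.I)‖ = 1 := Complex.norm_exp_ofReal_mul_I θ
  have h2 : (ℜ (Complex.exp (θ * Complex.I) • X) : Matrix (Fin n) (Fin n) ℂ)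
      = (2⁻¹ : ℂ) • (Complex.exp (θ * Complex.I) • X
        + star (Complex.exp (θ * Complex.I)) • star X) := by
    rw [realPart_apply_coe, star_smul, ← Complex.coe_smul]
    norm_num
  have h3 := map_add_le_add N (Complex.exp (θ * Complex.I) • X)
    (star (Complex.exp (θ * Complex.I)) • star X)
  simp only [map_smul_eq_mul, norm_star, h1, one_mul] at h3
  simp only [h2, map_smul_eq_mul]
  norm_num
  simpa using h3

end

/-! For the sector bound, diagonalise `Re(e^{iθ}X)` by a unitary `U`. Its eigenvalues are
`Re(e^{iθ}z_i)`, where the `z_i` are the diagonal entries of `U*XU`; these lie in `W(X)`, hence in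
`S_α`, so `|Re(e^{iθ}z_i)| ≤ |z_i| ≤ sec α · Re z_i`. Monotonicity on diagonal matrices
(`diagonal_mono`) and pinching (`diagonal_diag_le`) then give `N(Re(e^{iθ}X)) ≤ sec α · N(Re X)`.
Both rest on writing a matrix as an average of two unitary transforms of another. The second bound
is the triangle inequality with `N(X*) = N(X)`. -/

/-- The matrix `M` with the off-diagonal entries in the rows and columns of `s` set to zero. -/
def offDiagMask {n : ℕ} (s : Finset (Fin n)) (M : Matrix (Fin n) (Fin n) ℂ) :
    Matrix (Fin n) (Fin n) ℂ :=
  Matrix.of fun i j => if i = j ∨ (i ∉ s ∧ j ∉ s) then M i j else 0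

theorem Matrix.diagonal_mem_unitaryGroup {n : ℕ} {d : Fin n → ℂ} (hd : ∀ i, star (d i) * d i = 1) :
    Matrix.diagonal d ∈ Matrix.unitaryGroup (Fin n) ℂ := by
  rw [Matrix.mem_unitaryGroup_iff', Matrix.star_eq_conjTranspose, Matrix.diagonal_conjTranspose,
    Matrix.diagonal_mul_diagonal, ← Matrix.diagonal_one]
  exact congrArg _ (funext hd)

/-- Conjugation by the sign matrix with `-1` at `k` negates exactly the off-diagonal entries in row
and column `k`, so averaging kills them. -/
theorem offDiagMask_insert {n : ℕ} (s : Finset (Fin n)) (k : Fin n)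
    (M : Matrix (Fin n) (Fin n) ℂ) :
    offDiagMask (insert k s) M = (2⁻¹ : ℂ) • (offDiagMask s M +
      Matrix.diagonal (fun i => if i = k then (-1 : ℂ) else 1) * offDiagMask s M *
        Matrix.diagonal (fun i => if i = k then (-1 : ℂ) else 1)) := by
  ext i j
  simp only [offDiagMask, Matrix.smul_apply, Matrix.add_apply, Matrix.mul_diagonal,
    Matrix.diagonal_mul, Matrix.of_apply, Finset.mem_insert, smul_eq_mul]
  split_ifs <;> first | ring1 | grind

theorem Seminorm.half_smul_add_le {n : ℕ} {N : Seminorm ℂ (Matrix (Fin n) (Fin n) ℂ)}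
    {A B : Matrix (Fin n) (Fin n) ℂ} {c : ℝ} (hA : N A ≤ c) (hB : N B ≤ c) :
    N ((2⁻¹ : ℂ) • (A + B)) ≤ c := by
  have h := map_add_le_add N A B
  rw [map_smul_eq_mul]
  norm_num
  linarith

theorem IsAdmissibleNorm.offDiagMask_le {n : ℕ} {N : Seminorm ℂ (Matrix (Fin n) (Fin n) ℂ)}
    (hN : IsAdmissibleNorm N) (s : Finset (Fin n)) (M : Matrix (Fin n) (Fin n) ℂ) :
    N (offDiagMask s M) ≤ N M := by
  induction s using Finset.induction_on with
  | empty =>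
    apply le_of_eq
    congr 1
    ext i j
    simp [offDiagMask]
  | insert k s _ ih =>
    rw [offDiagMask_insert]
    have hU : Matrix.diagonal (fun i => if i = k then (-1 : ℂ) else 1) ∈
        Matrix.unitaryGroup (Fin n) ℂ :=
      Matrix.diagonal_mem_unitaryGroup fun i => by split_ifs <;> simp
    exact Seminorm.half_smul_add_le ih ((hN.unitarily_invariant _ _ hU _ hU).trans_le ih)

/-- Pinching to the diagonal does not increase a unitarily invariant norm. -/
theorem IsAdmissibleNorm.diagonal_diag_le {n : ℕ} {N : Seminorm ℂ (Matrix (Fin n) (Fin n) ℂ)}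
    (hN : IsAdmissibleNorm N) (M : Matrix (Fin n) (Fin n) ℂ) :
    N (Matrix.diagonal fun i => M i i) ≤ N M := by
  convert hN.offDiagMask_le Finset.univ M using 2
  ext i j
  by_cases h : i = j <;> simp [offDiagMask, Matrix.diagonal, h]

/-- A unitarily invariant norm is monotone in the moduli of the entries of a diagonal matrix. -/
theorem IsAdmissibleNorm.diagonal_mono {n : ℕ} {N : Seminorm ℂ (Matrix (Fin n) (Fin n) ℂ)}
    (hN : IsAdmissibleNorm N) {d c : Fin n → ℝ} (h : ∀ i, |d i| ≤ c i) :
    N (Matrix.diagonal fun i => (d i : ℂ)) ≤ N (Matrix.diagonal fun i => (c i : ℂ)) := by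
  -- Since `cos t = (e^{it} + e^{-it})/2`, this makes `diag d` the mean of two unitary multiples of
  -- `diag c`.
  have ht (i : Fin n) : ∃ t : ℝ, d i = c i * Real.cos t := by
    rcases (abs_nonneg _).trans (h i) |>.eq_or_lt with h0 | h0
    · exact ⟨0, by have := h i; rw [← h0] at this; simp [← h0, abs_nonpos_iff.mp this]⟩
    · have h1 := abs_le.mp (h i)
      refine ⟨Real.arccos (d i / c i), ?_⟩
      rw [Real.cos_arccos (by rw [le_div_iff₀ h0]; linarith) (by rw [div_le_one h0]; linarith)]
      field_simp
  choose t ht using ht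
  have hU (s : Fin n → ℝ) : Matrix.diagonal (fun i => Complex.exp (s i * Complex.I)) ∈
      Matrix.unitaryGroup (Fin n) ℂ :=
    Matrix.diagonal_mem_unitaryGroup fun i => by
      rw [Complex.star_def, ← Complex.normSq_eq_conj_mul_self, Complex.normSq_eq_norm_sq,
        Complex.norm_exp_ofReal_mul_I]
      simp
  have key : (Matrix.diagonal fun i => (d i : ℂ)) = (2⁻¹ : ℂ) •
      (Matrix.diagonal (fun i => Complex.exp (t i * Complex.I)) *
          Matrix.diagonal (fun i => (c i : ℂ)) * 1 +
        Matrix.diagonal (fun i => Complex.exp ((-t i : ℝ) * Complex.I)) *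
          Matrix.diagonal (fun i => (c i : ℂ)) * 1) := by
    simp only [mul_one, Matrix.diagonal_mul_diagonal, Matrix.diagonal_add, ← Matrix.diagonal_smul]
    congr 1
    ext i
    simp only [Pi.smul_apply, smul_eq_mul, ht i, Complex.ofReal_mul, Complex.ofReal_cos,
      Complex.cos, Complex.ofReal_neg]
    ring
  rw [key]
  exact Seminorm.half_smul_add_le
    (hN.unitarily_invariant _ _ (hU t) _ (one_mem _)).le
    (hN.unitarily_invariant _ _ (hU fun i => -t i) _ (one_mem _)).le

/-- Squaring `|y| cos α ≤ x sin α` gives `(x² + y²) cos² α ≤ x²`, that is `|z| ≤ sec α · Re z`. -/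
theorem Complex.abs_re_exp_mul_le_of_mem_sector {α : ℝ} (h0 : 0 ≤ α) (h1 : α < Real.pi / 2)
    {z : ℂ} (hz : z ∈ sector α) (θ : ℝ) :
    |(Complex.exp (θ * Complex.I) * z).re| ≤ 1 / Real.cos α * z.re := by
  obtain ⟨hre, him⟩ := hz
  have hc : 0 < Real.cos α := Real.cos_pos_of_mem_Ioo ⟨by linarith [Real.pi_pos], h1⟩
  rw [one_div_mul_eq_div]
  apply (Complex.abs_re_le_norm _).trans
  rw [norm_mul, Complex.norm_exp_ofReal_mul_I, one_mul, Complex.norm_def,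
    Real.sqrt_le_left (by positivity), div_pow, le_div_iff₀ (by positivity), Complex.normSq_apply]
  rw [Real.tan_eq_sin_div_cos, div_mul_eq_mul_div, le_div_iff₀ hc] at him
  have h2 := pow_le_pow_left₀ (by positivity) him 2
  rw [mul_pow, sq_abs, mul_pow] at h2
  nlinarith [Real.sin_sq_add_cos_sq α]

theorem Matrix.conj_diag_mem_numericalRange {n : ℕ} (X : Matrix (Fin n) (Fin n) ℂ)
    {U : Matrix (Fin n) (Fin n) ℂ} (hU : U ∈ Matrix.unitaryGroup (Fin n) ℂ) (i : Fin n) :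
    (star U * X * U) i i ∈ numericalRange X := by
  have key (Y : Matrix (Fin n) (Fin n) ℂ) :
      inner ℂ (WithLp.toLp 2 (U.col i)) (Matrix.toEuclideanLin Y (WithLp.toLp 2 (U.col i))) =
        (star U * Y * U) i i := by
    rw [Matrix.mul_assoc]
    simp [EuclideanSpace.inner_eq_star_dotProduct, Matrix.toLpLin_apply, Matrix.mul_apply,
      dotProduct, Matrix.mulVec, Matrix.col, Matrix.star_eq_conjTranspose, mul_comm]
  refine ⟨WithLp.toLp 2 (U.col i), ?_, key X⟩
  -- With `Y = 1`, `U*U = 1` shows that the column is a unit vector.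
  have h := key 1
  rw [mul_one, Matrix.mem_unitaryGroup_iff'.mp hU, Matrix.toLpLin_one] at h
  simp only [LinearMap.id_apply, inner_self_eq_norm_sq_to_K, Matrix.one_apply_eq] at h
  have h' : ‖WithLp.toLp 2 (U.col i)‖ ^ 2 = 1 := Complex.ofReal_injective (by simpa using h)
  exact (pow_eq_one_iff_of_nonneg (norm_nonneg _) two_ne_zero).mp h'

theorem Matrix.realPart_conj {n : ℕ} (X U : Matrix (Fin n) (Fin n) ℂ) :
    (ℜ (star U * X * U) : Matrix (Fin n) (Fin n) ℂ) =
      star U * (ℜ X : Matrix (Fin n) (Fin n) ℂ) * U := by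
  simp [realPart_apply_coe, mul_add, add_mul, mul_assoc]

theorem Matrix.realPart_diag {n : ℕ} (X : Matrix (Fin n) (Fin n) ℂ) (i : Fin n) :
    (ℜ X : Matrix (Fin n) (Fin n) ℂ) i i = ((X i i).re : ℂ) := by
  rw [realPart_apply_coe]
  apply Complex.ext <;> simp [Matrix.star_apply]
  ring

theorem IsAdmissibleNorm.realPart_rotate_le {n : ℕ}
    {N : Seminorm ℂ (Matrix (Fin n) (Fin n) ℂ)} (hN : IsAdmissibleNorm N) {α : ℝ} (h0 : 0 ≤ α)
    (h1 : α < Real.pi / 2) {X : Matrix (Fin n) (Fin n) ℂ} (hX : numericalRange X ⊆ sector α)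
    (θ : ℝ) :
    N (ℜ (Complex.exp (θ * Complex.I) • X) : Matrix (Fin n) (Fin n) ℂ) ≤
      1 / Real.cos α * N (ℜ X : Matrix (Fin n) (Fin n) ℂ) := by
  have hc : 0 < Real.cos α := Real.cos_pos_of_mem_Ioo ⟨by linarith [Real.pi_pos], h1⟩
  have hH : (ℜ (Complex.exp (θ * Complex.I) • X) : Matrix (Fin n) (Fin n) ℂ).IsHermitian :=
    (ℜ (Complex.exp (θ * Complex.I) • X)).2
  set U : Matrix (Fin n) (Fin n) ℂ := hH.eigenvectorUnitary.1
  have hU : U ∈ Matrix.unitaryGroup (Fin n) ℂ := hH.eigenvectorUnitary.2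
  have hinv (Y : Matrix (Fin n) (Fin n) ℂ) : N (star U * Y * U) = N Y :=
    hN.unitarily_invariant _ _ (Unitary.star_mem hU) _ hU
  have hdiag : star U * (ℜ (Complex.exp (θ * Complex.I) • X) : Matrix (Fin n) (Fin n) ℂ) * U =
      Matrix.diagonal fun i => ((Complex.exp (θ * Complex.I) * (star U * X * U) i i).re : ℂ) := by
    -- The spectral theorem is needed only for diagonality; the entries are then read off the
    -- diagonal.
    obtain ⟨d, hd⟩ : ∃ d : Fin n → ℂ, star U *
        (ℜ (Complex.exp (θ * Complex.I) • X) : Matrix (Fin n) (Fin n) ℂ) * U =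
          Matrix.diagonal d :=
      ⟨_, (Unitary.conjStarAlgAut_star_apply _ _).symm.trans
        hH.conjStarAlgAut_star_eigenvectorUnitary⟩
    rw [hd]
    congr 1
    ext i
    have := congrFun (congrFun hd i) i
    rw [Matrix.diagonal_apply_eq, ← Matrix.realPart_conj, Matrix.realPart_diag] at this
    rw [← this]
    simp
  calc N (ℜ (Complex.exp (θ * Complex.I) • X) : Matrix (Fin n) (Fin n) ℂ)
      = N (Matrix.diagonal fun i =>
          ((Complex.exp (θ * Complex.I) * (star U * X * U) i i).re : ℂ)) := by
        rw [← hdiag, hinv]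
    _ ≤ N (Matrix.diagonal fun i => ((1 / Real.cos α * ((star U * X * U) i i).re : ℝ) : ℂ)) :=
        hN.diagonal_mono fun i => Complex.abs_re_exp_mul_le_of_mem_sector h0 h1
          (hX (Matrix.conj_diag_mem_numericalRange X hU i)) θ
    _ = N (((1 / Real.cos α : ℝ) : ℂ) • Matrix.diagonal fun i =>
          (ℜ (star U * X * U) : Matrix (Fin n) (Fin n) ℂ) i i) := by
        rw [← Matrix.diagonal_smul]
        congr 2
        ext i
        simp [Matrix.realPart_diag]
    _ = 1 / Real.cos α * N (Matrix.diagonal fun i =>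
          (ℜ (star U * X * U) : Matrix (Fin n) (Fin n) ℂ) i i) := by
        rw [map_smul_eq_mul, Complex.norm_of_nonneg (by positivity)]
    _ ≤ 1 / Real.cos α * N (ℜ X : Matrix (Fin n) (Fin n) ℂ) := by
        rw [← hinv (ℜ X : Matrix (Fin n) (Fin n) ℂ), ← Matrix.realPart_conj]
        gcongr
        exact hN.diagonal_diag_le _

theorem IsAdmissibleNorm.realPart_le {n : ℕ} {N : Seminorm ℂ (Matrix (Fin n) (Fin n) ℂ)}
    (hN : IsAdmissibleNorm N) (X : Matrix (Fin n) (Fin n) ℂ) :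
    N (ℜ X : Matrix (Fin n) (Fin n) ℂ) ≤ N X := by
  have h : (ℜ X : Matrix (Fin n) (Fin n) ℂ) = (2⁻¹ : ℂ) • (X + X.conjTranspose) := by
    rw [realPart_apply_coe, ← Complex.coe_smul, Matrix.star_eq_conjTranspose]
    norm_num
  rw [h]
  exact Seminorm.half_smul_add_le le_rfl (hN.self_adjoint X).le

theorem realPart_le_genNumericalRadius {n : ℕ} (N : Seminorm ℂ (Matrix (Fin n) (Fin n) ℂ))
    (X : Matrix (Fin n) (Fin n) ℂ) :
    N (ℜ X : Matrix (Fin n) (Fin n) ℂ) ≤ genNumericalRadius N X := by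
  simpa [genNumericalRadius] using le_ciSup (genNumericalRadius_bddAbove N X) 0

theorem mainTheorem7 {n : ℕ} (N : Seminorm ℂ (Matrix (Fin n) (Fin n) ℂ))
    (hN : IsAdmissibleNorm N) :
    (∀ (α : ℝ), 0 ≤ α → α < Real.pi / 2 →
      ∀ X : Matrix (Fin n) (Fin n) ℂ, numericalRange X ⊆ sector α →
        genNumericalRadius N X ≤
          (1 / Real.cos α) * genNumericalRadius N (ℜ X : Matrix (Fin n) (Fin n) ℂ)) ∧
    (∀ X : Matrix (Fin n) (Fin n) ℂ, genNumericalRadius N X ≤ N X) := by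
  refine ⟨fun α h0 h1 X hX => ciSup_le fun θ => ?_, fun X => ciSup_le fun θ => ?_⟩
  · have hc : 0 < Real.cos α := Real.cos_pos_of_mem_Ioo ⟨by linarith [Real.pi_pos], h1⟩
    refine (hN.realPart_rotate_le h0 h1 hX θ).trans ?_
    gcongr
    -- The term `θ = 0` of the supremum, with `ℜ (ℜ X) = ℜ X`.
    simpa using realPart_le_genNumericalRadius N (ℜ X : Matrix (Fin n) (Fin n) ℂ)
  · refine (hN.realPart_le _).trans ?_
    rw [map_smul_eq_mul, Complex.norm_exp_ofReal_mul_I, one_mul]
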